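/- For a positive integer $k$, a vector $\underline{\zeta}=(\zeta_1,\dots,\zeta_k)\in\mathbb{R}^k$ and $1\le j\le k+1$, let $\lambda_{k,j}(\underline{\zeta})$ (respectively $\widehat{\lambda}_{k,j}(\underline{\zeta})$) be the supremum in $[-\infty,\infty]$ of all $\eta\in\mathbb{R}$ such that the system $$|x|\le X,\qquad \max_{1\le i\le k}|\zeta_i x-y_i|\le X^{-\eta}$$ has at least $j$ linearly independent solutions $(x,y_1,\dots,y_k)\in\mathbb{Z}^{k+1}$ for arbitrarily large real $X$ (respectively for all sufficiently large real $X$). For $\zeta\in\mathbb{R}$ write $\lambda_{k,j}(\zeta)=\lambda_{k,j}(\zeta,\zeta^2,\dots,\zeta^k)$ and $\widehat{\lambda}_{k,j}(\zeta)=\widehat{\lambda}_{k,j}(\zeta,\zeta^2,\dots,\zeta^k)$. Theorem. Let $\zeta$ be a Liouville number, i.e. a real number such that for every $n\in\mathbb{N}$ there are integers $a,b$ with $b>1$ and $0<|\zeta-a/b|<b^{-n}$. Then for every positive integer $k$, $$\lambda_{k,1}(\zeta)=\infty,\qquad \frac1k\le\lambda_{k,j}(\zeta)\le\frac1{j-1}\quad(2\le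 j\le k+1),$$ $$\widehat{\lambda}_{k,1}(\zeta)=\frac1k,\qquad \widehat{\lambda}_{k,j}(\zeta)=0\quad(2\le j\le k+1).$$ -/

import Mathlib

namespace SimApprox

/-- The system `|x| ≤ X`, `max_{1 ≤ i ≤ k} |ζ_i x - y_i| ≤ X ^ (-η)` has (at least) `j` linearly
independent solutions `(x, y_1, …, y_k) ∈ ℤ^(k+1)`; coordinate `0` of a vector is `x`. -/
def HasIndepSolutions {k : ℕ} (ζ : Fin k → ℝ) (j : ℕ) (η X : ℝ) : Prop :=
  ∃ v : Fin j → (Fin (k + 1) → ℤ), LinearIndependent ℤ v ∧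
    ∀ s : Fin j, |(v s 0 : ℝ)| ≤ X ∧ ∀ i : Fin k, |ζ i * (v s 0 : ℝ) - (v s i.succ : ℝ)| ≤ X ^ (-η)

/-- The ordinary constant `λ_{k,j}(ζ)`: the supremum, in the extended reals, of all real `η` such
that the system has `j` linearly independent solutions for arbitrarily large real `X`. -/
noncomputable def lam {k : ℕ} (ζ : Fin k → ℝ) (j : ℕ) : EReal :=
  sSup {e : EReal | ∃ η : ℝ, (η : EReal) = e ∧
    ∀ X₀ : ℝ, ∃ X : ℝ, X₀ ≤ X ∧ 0 < X ∧ HasIndepSolutions ζ j η X}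

/-- The uniform constant `\hat λ_{k,j}(ζ)`: the supremum, in the extended reals, of all real `η`
such that the system has `j` linearly independent solutions for all sufficiently large `X`. -/
noncomputable def lamHat {k : ℕ} (ζ : Fin k → ℝ) (j : ℕ) : EReal :=
  sSup {e : EReal | ∃ η : ℝ, (η : EReal) = e ∧
    ∃ X₀ : ℝ, 0 < X₀ ∧ ∀ X : ℝ, X₀ ≤ X → HasIndepSolutions ζ j η X}

/-- The vector of successive powers `(ζ, ζ², …, ζ^k)`. -/
def powerVec (k : ℕ) (ζ : ℝ) : Fin k → ℝ := fun i => ζ ^ ((i : ℕ) + 1)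

end SimApprox

namespace SimApprox

/-! Let `a / b` be a reduced fraction extremely close to `ζ`. Everything specific to Liouville
numbers comes from the integer map `v ↦ (b v_{i+1} - a v_i)`, whose kernel is the line through
`(b^k, a b^(k-1), …, a^k)`.

Uniform upper bounds: for `X = b^m` with `m η > 1`, any solution has an image of entries below 1 in
absolute value, so it lies on this line (`exists_rat_forall_collinear`). Hence two solutions are
never independent; and since `b^k` divides the first coordinate on the line, there is no nonzero
solution if `m < k`.

Ordinary lower bounds: the kernel vector itself approximates arbitrarily well, so `λ_{k,1} = ∞`. The
map is surjective, and lifting the unit vectors gives `k` further vectors with errors `O(1/b)` and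
first coordinate at most `b^k`, hence `λ_{k,j} ≥ 1/k`.

The remaining bounds hold for every vector: `λ_{k,j} ≤ 1/(j-1)` because a nonzero integer minor has
absolute value at least 1, `\hat λ_{k,1} ≥ 1/k` by Dirichlet, and `\hat λ_{k,j} ≥ 0` by rounding. -/

/-! ### Minors and the bound `1 / (j - 1)`. -/

theorem abs_det_le_of_abs_le_mul {n : Type*} [Fintype n] [DecidableEq n] (A : Matrix n n ℝ)
    (α β : n → ℝ) (h : ∀ p q, |A p q| ≤ α p * β q) :
    |A.det| ≤ (Fintype.card n).factorial * ((∏ p, α p) * ∏ q, β q) := by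
  rw [Matrix.det_apply]
  refine (Finset.abs_sum_le_sum_abs _ _).trans ?_
  rw [← Fintype.card_perm, ← nsmul_eq_mul]
  refine Finset.sum_le_card_nsmul _ _ _ fun σ _ => ?_
  have h1 : |Equiv.Perm.sign σ • ∏ i, A (σ i) i| = ∏ i, |A (σ i) i| := by
    rcases Int.units_eq_one_or (Equiv.Perm.sign σ) with h | h <;> simp [h, Finset.abs_prod]
  rw [h1]
  calc ∏ i, |A (σ i) i| ≤ ∏ i, α (σ i) * β i :=
        Finset.prod_le_prod (fun _ _ => abs_nonneg _) fun i _ => h _ _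
    _ = _ := by rw [Finset.prod_mul_distrib, Equiv.prod_comp σ α]

/-- A perturbation `u ⊗ w + E` of a rank one matrix has a determinant that is at most of
the order of `X * δ ^ (j - 1)`, where `X` bounds `u` and `δ` bounds `E`. -/
theorem abs_det_rank_one_add_le {j : ℕ} (u w : Fin j → ℝ) (E : Matrix (Fin j) (Fin j) ℝ)
    {C X δ : ℝ} (hC : 1 ≤ C) (hδ : 0 < δ) (hδX : δ ≤ X) (hu : ∀ s, |u s| ≤ X)
    (hw : ∀ t, |w t| ≤ C) (hE : ∀ s t, |E s t| ≤ δ) :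
    |(Matrix.of fun s t => u s * w t + E s t).det| ≤ (j + 1).factorial * (C / δ * (X * δ ^ j)) := by
  have hX : 0 < X := hδ.trans_le hδX
  -- Bordering turns `u ⊗ w + E` into a Schur complement with the same determinant. The weight `C /
  -- δ` on the border row makes the entrywise product bound fit all four blocks.
  have key := abs_det_le_of_abs_le_mul
    (Matrix.fromBlocks (1 : Matrix Unit Unit ℝ) (Matrix.of fun _ t => w t)
      (Matrix.of fun s _ => - u s) E)
    (Sum.elim (fun _ => C / δ) fun _ => 1) (Sum.elim (fun _ => X) fun _ => δ) (by
      rintro (p | p) (q | q)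
      · simp only [Matrix.fromBlocks_apply₁₁, Sum.elim_inl]
        rw [Subsingleton.elim p q, Matrix.one_apply_eq, abs_one, div_mul_eq_mul_div, one_le_div hδ]
        nlinarith
      · simpa [div_mul_cancel₀ _ hδ.ne'] using hw q
      · simpa using hu p
      · simpa using hE p q)
  rw [Matrix.det_fromBlocks_one₁₁] at key
  convert key using 2
  · congr 2
    ext s t
    simp [Matrix.mul_apply]
    ring
  · simp [add_comm]
  · simp

/-- Linearly independent integer vectors have a nonvanishing maximal minor. -/
theorem exists_submatrix_det_ne_zero {j n : ℕ} {v : Fin j → Fin n → ℤ}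
    (hv : LinearIndependent ℤ v) :
    ∃ c : Fin j → Fin n, (Matrix.of fun s t => v s (c t)).det ≠ 0 := by
  let φ : (Fin n → ℤ) →ₗ[ℤ] (Fin n → ℚ) :=
    (Int.castAddHom ℚ).toIntLinearMap.compLeft (Fin n)
  have hφ : LinearMap.ker φ = ⊥ := by
    refine LinearMap.ker_eq_bot.2 fun x y h => funext fun i => ?_
    have := congrFun h i
    simpa [φ] using this
  have hQ : LinearIndependent ℚ (φ ∘ v) :=
    (LinearIndependent.iff_fractionRing ℤ ℚ).1 (hv.map' φ hφ)
  let A : Matrix (Fin j) (Fin n) ℚ := Matrix.of (φ ∘ v)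
  have hr : A.rank = j := by simpa using LinearIndependent.rank_matrix (M := A) hQ
  have hfr : Module.finrank ℚ (Submodule.span ℚ (Set.range A.col)) = j := by
    rw [← Matrix.rank_eq_finrank_span_cols, hr]
  obtain ⟨f, hf, -, hfi⟩ := Submodule.exists_fun_fin_finrank_span_eq ℚ (Set.range A.col)
  choose c hc using hf
  refine ⟨fun t => c (Fin.cast hfr.symm t), fun h0 => ?_⟩
  have hcols : LinearIndependent ℚ
      (Matrix.of fun s t => (v s (c (Fin.cast hfr.symm t)) : ℚ)).col := by
    have e : (Matrix.of fun s t => (v s (c (Fin.cast hfr.symm t)) : ℚ)).col =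
        f ∘ Fin.cast hfr.symm := by
      funext t s
      simp only [Function.comp, ← hc]
      simp [A, φ]
    rw [e]
    exact hfi.comp _ (Fin.cast_injective _)
  rw [Matrix.linearIndependent_cols_iff_isUnit, Matrix.isUnit_iff_isUnit_det] at hcols
  refine hcols.ne_zero ?_
  have := congrArg (Int.cast : ℤ → ℚ) h0
  rwa [Int.cast_det, Int.cast_zero] at this

theorem HasIndepSolutions.of_le {k j j' : ℕ} {ζ : Fin k → ℝ} {η X : ℝ} (hj : j' ≤ j)
    (h : HasIndepSolutions ζ j η X) : HasIndepSolutions ζ j' η X := by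
  obtain ⟨v, hv, hs⟩ := h
  exact ⟨v ∘ Fin.castLE hj, hv.comp _ (Fin.castLE_injective hj), fun s => hs _⟩

theorem le_lam {k : ℕ} {ζ : Fin k → ℝ} {j : ℕ} {c : ℝ} (hc : 0 < c)
    (h : ∀ η : ℝ, 0 < η → η < c → ∀ X₀ : ℝ, ∃ X : ℝ, X₀ ≤ X ∧ 0 < X ∧ HasIndepSolutions ζ j η X) :
    (c : EReal) ≤ lam ζ j := by
  refine le_of_forall_lt fun d hd => ?_
  obtain ⟨η, hη, hηc⟩ := EReal.lt_iff_exists_real_btwn.1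
    (max_lt hd (EReal.coe_lt_coe_iff.2 hc) : max d ((0 : ℝ) : EReal) < c)
  obtain ⟨h1, h2⟩ := max_lt_iff.1 hη
  exact h1.trans_le (le_sSup ⟨η, rfl, h η (EReal.coe_lt_coe_iff.1 h2) (EReal.coe_lt_coe_iff.1 hηc)⟩)

theorem le_lamHat {k : ℕ} {ζ : Fin k → ℝ} {j : ℕ} {c : ℝ} (hc : 0 < c)
    (h : ∀ η : ℝ, 0 < η → η < c → ∃ X₀ : ℝ, 0 < X₀ ∧ ∀ X : ℝ, X₀ ≤ X → HasIndepSolutions ζ j η X) :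
    (c : EReal) ≤ lamHat ζ j := by
  refine le_of_forall_lt fun d hd => ?_
  obtain ⟨η, hη, hηc⟩ := EReal.lt_iff_exists_real_btwn.1
    (max_lt hd (EReal.coe_lt_coe_iff.2 hc) : max d ((0 : ℝ) : EReal) < c)
  obtain ⟨h1, h2⟩ := max_lt_iff.1 hη
  exact h1.trans_le (le_sSup ⟨η, rfl, h η (EReal.coe_lt_coe_iff.1 h2) (EReal.coe_lt_coe_iff.1 hηc)⟩)

/-- The bound `λ_{k,j} ≤ 1 / (j - 1)`, valid for every vector. -/
theorem lam_le {k : ℕ} (ζ : Fin k → ℝ) {j : ℕ} (hj : 2 ≤ j) :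
    lam ζ j ≤ ((1 / ((j : ℝ) - 1) : ℝ) : EReal) := by
  refine sSup_le ?_
  rintro _ ⟨η, rfl, h⟩
  rw [EReal.coe_le_coe_iff]
  by_contra! hlt
  have hj1 : (0 : ℝ) < (j : ℝ) - 1 := by
    have : (2 : ℝ) ≤ j := by exact_mod_cast hj
    linarith
  have hη : 0 < η := (by positivity : 0 < 1 / ((j : ℝ) - 1)).trans hlt
  have hexp : 1 < η * ((j : ℝ) - 1) := (div_lt_iff₀ hj1).1 hlt
  obtain ⟨C, hC1, hC⟩ : ∃ C : ℝ, 1 ≤ C ∧ ∀ i, |ζ i| ≤ C := by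
    refine ⟨1 + ∑ i, |ζ i|, by simpa using Finset.sum_nonneg fun i _ => abs_nonneg (ζ i), fun i => ?_⟩
    have := Finset.single_le_sum (fun i _ => abs_nonneg (ζ i)) (Finset.mem_univ i)
    linarith
  -- Up to a constant, a minor is at most `X · X^(-η (j-1))`, which tends to 0.
  have hlim : Filter.Tendsto (fun X : ℝ => ((j + 1).factorial * C : ℝ) *
      X ^ (-(η * ((j : ℝ) - 1) - 1))) Filter.atTop (nhds 0) := by
    simpa using (tendsto_rpow_neg_atTop (sub_pos.2 hexp)).const_mul ((j + 1).factorial * C : ℝ)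
  obtain ⟨X₀, hX₀⟩ := Filter.eventually_atTop.1
    ((hlim.eventually_lt_const one_pos).and (Filter.eventually_ge_atTop 1))
  obtain ⟨X, hX, hX0, v, hv, hs⟩ := h X₀
  obtain ⟨hsmall, hX1⟩ := hX₀ X hX
  obtain ⟨c, hc⟩ := exists_submatrix_det_ne_zero hv
  have hdet : (1 : ℝ) ≤ |((Matrix.of fun s t => v s (c t)).det : ℤ)| := by
    exact_mod_cast Int.one_le_abs hc
  have hδ : 0 < X ^ (-η) := Real.rpow_pos_of_pos hX0 _
  have hδ1 : X ^ (-η) ≤ 1 := Real.rpow_le_one_of_one_le_of_nonpos hX1 (by linarith)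
  let w : Fin (k + 1) → ℝ := Fin.cons 1 ζ
  have key := abs_det_rank_one_add_le (fun s => (v s 0 : ℝ)) (fun t => w (c t))
    (Matrix.of fun s t => (v s (c t) : ℝ) - v s 0 * w (c t)) hC1 hδ (hδ1.trans hX1)
    (fun s => (hs s).1)
    (fun t => by
      rcases Fin.eq_zero_or_eq_succ (c t) with h | ⟨i, h⟩ <;> rw [h]
      · simpa [w] using hC1
      · simpa [w] using hC i)
    (fun s t => by
      rw [Matrix.of_apply]
      rcases Fin.eq_zero_or_eq_succ (c t) with h | ⟨i, h⟩ <;> rw [h]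
      · simpa [w] using hδ.le
      · simpa [w, abs_sub_comm, mul_comm] using (hs s).2 i)
  have hA : ((Matrix.of fun s t => v s (c t)).det : ℝ) = (Matrix.of fun s t =>
      (v s 0 : ℝ) * w (c t) +
        (Matrix.of fun s t => (v s (c t) : ℝ) - v s 0 * w (c t)) s t).det := by
    rw [Int.cast_det]
    congr 1
    ext s t
    simp
  rw [Int.cast_abs, hA] at hdet
  have hpow : C / X ^ (-η) * (X * (X ^ (-η)) ^ j) = C * X ^ (-(η * ((j : ℝ) - 1) - 1)) := by
    have e : X ^ (-(η * ((j : ℝ) - 1) - 1)) = X * (X ^ (-η)) ^ j / X ^ (-η) := by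
      rw [← Real.rpow_natCast, ← Real.rpow_mul hX0.le, ← Real.rpow_one_add' hX0.le,
        ← Real.rpow_sub hX0]
      · congr 1
        ring
      · nlinarith
    rw [e]
    ring
  rw [hpow, ← mul_assoc] at key
  linarith

/-! ### Rational approximations and the uniform upper bounds. -/

/-- Approximations in lowest terms to a Liouville number have arbitrarily large denominators. -/
theorem exists_rat_close {ζ : ℝ} (hζ : Liouville ζ) (n B : ℕ) :
    ∃ r : ℚ, B ≤ r.den ∧ |ζ - r| ≤ 1 / (r.den : ℝ) ^ n := by
  -- Rationals of denominator at most `B` stay at distance at least `ε` from the irrational `ζ`. The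
  -- spare factor in the exponent `n + 1` gives an error at most `1 / b < ε`.
  obtain ⟨ε, hε, hε0⟩ := ((Filter.Eventually.filter_mono nhdsWithin_le_nhds
    (hζ.irrational.eventually_forall_le_dist_cast_rat_of_den_le B)).and
      (self_mem_nhdsWithin (a := (0 : ℝ)) (s := Set.Ioi 0))).exists
  have hε0 : (0 : ℝ) < ε := hε0
  have hev : ∀ᶠ b : ℕ in Filter.atTop, 1 / (b : ℝ) < ε :=
    tendsto_one_div_atTop_nhds_zero_nat.eventually_lt_const hε0
  obtain ⟨b, ⟨a, -, hab⟩, hb, hb1⟩ := ((hζ.frequently_exists_num (n + 1)).and_eventually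
    (hev.and (Filter.eventually_ge_atTop 1))).exists
  have hb1' : (1 : ℝ) ≤ b := by exact_mod_cast hb1
  let r : ℚ := a / b
  have hr : ((r : ℚ) : ℝ) = a / b := by simp [r]
  have hden : r.den ≤ b := by
    have : r.den ∣ b := by
      have h := Rat.den_dvd a b
      rw [Rat.divInt_eq_div, Int.cast_natCast] at h
      exact Int.natCast_dvd_natCast.1 h
    exact Nat.le_of_dvd hb1 this
  have hd0 : (0 : ℝ) < r.den := by exact_mod_cast r.den_pos
  refine ⟨r, ?_, ?_⟩
  · by_contra! hlt
    have h1 := hε r hlt.le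
    rw [Real.dist_eq, hr] at h1
    have h2 : 1 / (b : ℝ) ^ (n + 1) ≤ 1 / b := by
      gcongr
      exact le_self_pow₀ hb1' (by omega)
    linarith
  · rw [hr]
    refine hab.le.trans ?_
    calc 1 / (b : ℝ) ^ (n + 1) ≤ 1 / (b : ℝ) ^ n := by
          gcongr
          omega
      _ ≤ 1 / (r.den : ℝ) ^ n := by
          have : (r.den : ℝ) ≤ b := by exact_mod_cast hden
          gcongr

theorem abs_pow_sub_pow_le_of_abs_le {x y M : ℝ} (hx : |x| ≤ M) (hy : |y| ≤ M) (hM : 1 ≤ M)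
    {i k : ℕ} (hi : i ≤ k) : |x ^ i - y ^ i| ≤ k * M ^ k * |x - y| := by
  have h1 := abs_pow_sub_pow_le x y i
  have h2 : max |x| |y| ^ (i - 1) ≤ M ^ k :=
    (pow_le_pow_left₀ (le_max_of_le_left (abs_nonneg x)) (max_le hx hy) _).trans
      (pow_le_pow_right₀ hM (by omega))
  have h3 : (i : ℝ) ≤ k := by exact_mod_cast hi
  calc |x ^ i - y ^ i| ≤ |x - y| * i * max |x| |y| ^ (i - 1) := h1
    _ ≤ |x - y| * k * M ^ k := by gcongr
    _ = _ := by ring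

theorem abs_cast_le_of_abs_sub_le_one {ζ : ℝ} {r : ℚ} (h : |ζ - r| ≤ 1) :
    |(r : ℝ)| ≤ |ζ| + 1 := by
  have := abs_sub_abs_le_abs_sub (r : ℝ) ζ
  rw [abs_sub_comm] at this
  linarith

theorem cast_num_eq (r : ℚ) : (r.num : ℝ) = r.den * r := by
  have : (r.den : ℝ) ≠ 0 := by exact_mod_cast r.den_nz
  rw [Rat.cast_def]
  field_simp

/-- Very good approximations to `(ζ, …, ζ^k)` with small first coordinate lie on the line spanned
by `(b^k, a b^(k-1), …, a^k)`, if `a / b` is very close to `ζ`. -/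
theorem exists_rat_forall_collinear {ζ : ℝ} (hζ : Liouville ζ) (k : ℕ) {m η : ℝ} (hm : 0 < m)
    (h : 1 < m * η) (X₀ : ℝ) :
    ∃ r : ℚ, 1 < r.den ∧ X₀ ≤ (r.den : ℝ) ^ m ∧ ∀ v : Fin (k + 1) → ℤ,
      |(v 0 : ℝ)| ≤ (r.den : ℝ) ^ m →
      (∀ i : Fin k, |powerVec k ζ i * (v 0 : ℝ) - (v i.succ : ℝ)| ≤ ((r.den : ℝ) ^ m) ^ (-η)) →
      ∀ i : Fin (k + 1), (r.den : ℤ) ^ (i : ℕ) * v i = r.num ^ (i : ℕ) * v 0 := by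
  set M : ℝ := |ζ| + 1 with hM
  have hM1 : 1 ≤ M := by simp [hM]
  -- With this `n`, `b · |ζ - r| · b^m ≤ 1 / b`.
  obtain ⟨n, hn⟩ := exists_nat_ge (m + 2)
  have hlim : Filter.Tendsto (fun b : ℝ => (M + 1) * b ^ (-(m * η - 1)) + M ^ k * b ^ (-(1 : ℝ)))
      Filter.atTop (nhds 0) := by
    simpa using ((tendsto_rpow_neg_atTop (sub_pos.2 h)).const_mul (M + 1)).add
      ((tendsto_rpow_neg_atTop one_pos).const_mul (M ^ k))
  have hev : ∀ᶠ b : ℝ in Filter.atTop, (M + 1) * b ^ (-(m * η - 1)) + M ^ k * b ^ (-(1 : ℝ)) < 1 :=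
    hlim.eventually_lt_const one_pos
  obtain ⟨B, hB⟩ := Filter.eventually_atTop.1 (tendsto_natCast_atTop_atTop.eventually
    (hev.and ((tendsto_rpow_atTop hm).eventually_ge_atTop X₀)))
  obtain ⟨r, hrB, hr⟩ := exists_rat_close hζ n (max B 2)
  obtain ⟨hsmall, hX⟩ := hB r.den ((le_max_left _ _).trans hrB)
  have hd : 1 < r.den := (le_max_right B 2).trans hrB
  refine ⟨r, hd, hX, fun v hv0 hv => ?_⟩
  have hb1 : (1 : ℝ) < r.den := by exact_mod_cast hd
  set b : ℝ := (r.den : ℝ) with hb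
  have hb0 : 0 < b := one_pos.trans hb1
  set δ : ℝ := (b ^ m) ^ (-η) with hδ
  have hδe : δ = b ^ (-(m * η)) := by rw [hδ, ← Real.rpow_mul hb0.le, mul_neg]
  have hδ0 : 0 < δ := by rw [hδe]; positivity
  have herr : ∀ i : Fin (k + 1), |ζ ^ (i : ℕ) * (v 0 : ℝ) - v i| ≤ δ := by
    intro i
    rcases Fin.eq_zero_or_eq_succ i with h | ⟨i, h⟩ <;> rw [h]
    · simpa using hδ0.le
    · simpa [powerVec] using hv i
  have hr1 : |ζ - r| ≤ 1 := hr.trans (div_le_one_of_le₀ (one_le_pow₀ hb1.le) (by positivity))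
  have hrM : |(r : ℝ)| ≤ M := abs_cast_le_of_abs_sub_le_one hr1
  have hstep : ∀ i : Fin k, (r.den : ℤ) * v i.succ = r.num * v i.castSucc := by
    intro i
    rw [← sub_eq_zero, ← Int.abs_lt_one_iff]
    have e : (((r.den : ℤ) * v i.succ - r.num * v i.castSucc : ℤ) : ℝ) =
        b * (ζ ^ (i : ℕ) * ((ζ - r) * v 0)) + b * r * (ζ ^ (i : ℕ) * v 0 - v i.castSucc) -
          b * (ζ ^ ((i : ℕ) + 1) * v 0 - v i.succ) := by
      push_cast
      rw [cast_num_eq, ← hb]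
      ring
    have h1 := herr i.castSucc
    have h2 := herr i.succ
    rw [Fin.val_castSucc] at h1
    rw [Fin.val_succ] at h2
    have h3 : |ζ ^ (i : ℕ)| ≤ M ^ k := by
      rw [abs_pow]
      exact (pow_le_pow_left₀ (abs_nonneg _) (by simp [hM]) _).trans
        (pow_le_pow_right₀ hM1 i.2.le)
    have hX : 1 / b ^ n * b ^ m ≤ b ^ (-(2 : ℝ)) := by
      rw [one_div, ← Real.rpow_natCast, ← Real.rpow_neg hb0.le, ← Real.rpow_add hb0]
      exact Real.rpow_le_rpow_of_exponent_le hb1.le (by linarith)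
    have : |(((r.den : ℤ) * v i.succ - r.num * v i.castSucc : ℤ) : ℝ)| < 1 := by
      rw [e]
      calc _ ≤ |b * (ζ ^ (i : ℕ) * ((ζ - r) * v 0))| +
              |b * r * (ζ ^ (i : ℕ) * v 0 - v i.castSucc)| +
              |b * (ζ ^ ((i : ℕ) + 1) * v 0 - v i.succ)| :=
            (abs_sub _ _).trans (add_le_add_left (abs_add_le _ _) _)
        _ ≤ b * (M ^ k * (1 / b ^ n * b ^ m)) + b * M * δ + b * δ := by
            simp only [abs_mul, abs_of_pos hb0]
            gcongr
        _ ≤ b * (M ^ k * b ^ (-(2 : ℝ))) + b * M * δ + b * δ := by gcongr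
        _ = (M + 1) * b ^ (-(m * η - 1)) + M ^ k * b ^ (-(1 : ℝ)) := by
            have e1 : b ^ (-(m * η - 1)) = b * δ := by
              rw [hδe, ← Real.rpow_one_add' hb0.le (by linarith)]
              congr 1
              ring
            have e2 : b ^ (-(1 : ℝ)) = b * b ^ (-(2 : ℝ)) := by
              rw [← Real.rpow_one_add' hb0.le (by norm_num)]
              norm_num
            rw [e1, e2]
            ring
        _ < 1 := hsmall
    exact_mod_cast this
  intro i
  induction i using Fin.induction with
  | zero => simp
  | succ i ih =>
    rw [Fin.val_castSucc] at ih
    rw [Fin.val_succ, pow_succ, mul_assoc, hstep i, pow_succ, mul_right_comm, ← ih]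
    ring

/-- Collinearity and coprimality force `b^k` to divide the first coordinate, which is smaller than
`b^k` when `1 / η < m < k`; so it vanishes, and with it the whole vector. -/
theorem lamHat_one_le {ζ : ℝ} (hζ : Liouville ζ) {k : ℕ} (hk : 1 ≤ k) :
    lamHat (powerVec k ζ) 1 ≤ ((1 / (k : ℝ) : ℝ) : EReal) := by
  refine sSup_le ?_
  rintro _ ⟨η, rfl, X₀, -, h⟩
  rw [EReal.coe_le_coe_iff]
  by_contra! hlt
  have hk0 : (0 : ℝ) < k := by exact_mod_cast hk
  have hη : 0 < η := (by positivity : 0 < 1 / (k : ℝ)).trans hlt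
  obtain ⟨m, hm1, hmk⟩ := exists_between ((one_div_lt hk0 hη).1 hlt)
  have hm0 : 0 < m := (one_div_pos.2 hη).trans hm1
  obtain ⟨r, hd, hX, hr⟩ := exists_rat_forall_collinear hζ k hm0 ((div_lt_iff₀ hη).1 hm1) X₀
  obtain ⟨v, hv, hs⟩ := h _ hX
  have hcol := hr (v 0) (hs 0).1 (hs 0).2
  have hb0 : (r.den : ℤ) ≠ 0 := by exact_mod_cast r.den_nz
  have hcop : IsCoprime ((r.den : ℤ) ^ k) (r.num ^ k) :=
    (Int.isCoprime_iff_nat_coprime.2 (by simpa using r.reduced.symm)).pow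
  have hdvd : (r.den : ℤ) ^ k ∣ v 0 0 := by
    refine hcop.dvd_of_dvd_mul_left ⟨v 0 (Fin.last k), ?_⟩
    simpa using (hcol (Fin.last k)).symm
  have hlt : |v 0 0| < (r.den : ℤ) ^ k := by
    have h1 : |((v 0 0 : ℤ) : ℝ)| < (r.den : ℝ) ^ k := by
      refine (hs 0).1.trans_lt ?_
      rw [← Real.rpow_natCast]
      exact Real.rpow_lt_rpow_of_exponent_lt (by exact_mod_cast hd) hmk
    exact_mod_cast h1
  have h00 : v 0 0 = 0 := Int.eq_zero_of_abs_lt_dvd hdvd hlt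
  refine hv.ne_zero 0 (funext fun i => ?_)
  have := hcol i
  rw [h00, mul_zero, mul_eq_zero] at this
  exact this.resolve_left (pow_ne_zero _ hb0)

theorem lamHat_le_zero {ζ : ℝ} (hζ : Liouville ζ) (k : ℕ) {j : ℕ} (hj : 2 ≤ j) :
    lamHat (powerVec k ζ) j ≤ 0 := by
  refine sSup_le ?_
  rintro _ ⟨η, rfl, X₀, -, h⟩
  rw [← EReal.coe_zero, EReal.coe_le_coe_iff]
  by_contra! hη
  obtain ⟨r, hd, hX, hr⟩ := exists_rat_forall_collinear (η := η) hζ k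
    (by positivity : 0 < 2 / η) (by rw [div_mul_cancel₀ _ hη.ne']; norm_num) X₀
  obtain ⟨v, hv, hs⟩ := (h _ hX).of_le hj
  have hcol := fun s => hr (v s) (hs s).1 (hs s).2
  have hb0 : (r.den : ℤ) ≠ 0 := by exact_mod_cast r.den_nz
  -- Both vectors lie on one line, so cross-multiplying by first coordinates gives a relation.
  have hrel : v 1 0 • v 0 + (-v 0 0) • v 1 = 0 := by
    funext i
    refine (mul_eq_zero.1 ?_).resolve_left (pow_ne_zero (i : ℕ) hb0)
    have h0 := hcol 0 i
    have h1 := hcol 1 i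
    simp only [Pi.add_apply, Pi.smul_apply, smul_eq_mul]
    linear_combination v 1 0 * h0 - v 0 0 * h1
  have hpair : LinearIndependent ℤ ![v 0, v 1] := by
    convert hv using 1
    ext s
    fin_cases s <;> rfl
  have h00 := (LinearIndependent.pair_iff.1 hpair _ _ hrel).1
  refine hv.ne_zero 1 (funext fun i => ?_)
  have := hcol 1 i
  rw [h00, mul_zero, mul_eq_zero] at this
  exact this.resolve_left (pow_ne_zero _ hb0)

/-! ### Uniform lower bounds, for arbitrary vectors. -/

/-- Dirichlet's theorem on simultaneous approximation. -/
theorem exists_simultaneous_approx {k : ℕ} (ζ : Fin k → ℝ) {N Q : ℕ} (hN : 0 < N)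
    (hNQ : N ^ k ≤ Q) :
    ∃ v : Fin (k + 1) → ℤ, v ≠ 0 ∧ |v 0| ≤ Q ∧
      ∀ i : Fin k, |ζ i * (v 0 : ℝ) - v i.succ| ≤ 1 / N := by
  have hN' : (0 : ℝ) < N := by exact_mod_cast hN
  -- Pigeonhole: `Q + 1` multiples fall into `N^k ≤ Q` boxes of side `1 / N`.
  let f : ℕ → Fin k → Fin N := fun x i => ⟨⌊N * Int.fract (ζ i * x)⌋₊, by
    have h1 := Int.fract_lt_one (ζ i * x)
    have h0 := Int.fract_nonneg (ζ i * x)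
    rw [Nat.floor_lt (by positivity)]
    nlinarith⟩
  obtain ⟨x, hx, y, hy, hxy, hf⟩ := Finset.exists_ne_map_eq_of_card_lt_of_maps_to
    (s := Finset.range (Q + 1)) (t := Finset.univ) (f := f) (by simpa using Nat.lt_succ_of_le hNQ)
    (fun _ _ => Finset.mem_coe.2 (Finset.mem_univ _))
  rw [Finset.mem_range] at hx hy
  refine ⟨Fin.cons ((x : ℤ) - y) fun i => ⌊ζ i * x⌋ - ⌊ζ i * y⌋, fun h => hxy ?_, ?_, fun i => ?_⟩
  · have := congrFun h 0
    simp only [Fin.cons_zero, Pi.zero_apply] at this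
    omega
  · rw [Fin.cons_zero, abs_le]
    omega
  · have h1 : ⌊N * Int.fract (ζ i * x)⌋₊ = ⌊N * Int.fract (ζ i * y)⌋₊ :=
      congrArg Fin.val (congrFun hf i)
    have hx1 := Nat.floor_le (mul_nonneg hN'.le (Int.fract_nonneg (ζ i * x)))
    have hx2 := Nat.lt_floor_add_one (N * Int.fract (ζ i * x))
    have hy1 := Nat.floor_le (mul_nonneg hN'.le (Int.fract_nonneg (ζ i * y)))
    have hy2 := Nat.lt_floor_add_one (N * Int.fract (ζ i * y))
    rw [h1] at hx1 hx2
    rw [le_div_iff₀ hN', ← abs_of_pos hN', ← abs_mul]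
    have e : (ζ i * ((Fin.cons ((x : ℤ) - y) fun i => ⌊ζ i * x⌋ - ⌊ζ i * y⌋ :
        Fin (k + 1) → ℤ) 0 : ℝ) - ((Fin.cons ((x : ℤ) - y) fun i => ⌊ζ i * x⌋ - ⌊ζ i * y⌋ :
        Fin (k + 1) → ℤ) i.succ : ℝ)) * N = N * Int.fract (ζ i * x) - N * Int.fract (ζ i * y) := by
      simp only [Fin.cons_zero, Fin.cons_succ, Int.fract]
      push_cast
      ring
    rw [e, abs_le]
    constructor <;> linarith

theorem one_div_le_lamHat_one {k : ℕ} (hk : 1 ≤ k) (ζ : Fin k → ℝ) :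
    ((1 / (k : ℝ) : ℝ) : EReal) ≤ lamHat ζ 1 := by
  have hk0 : (0 : ℝ) < k := by exact_mod_cast hk
  refine le_lamHat (by positivity) fun η hη hηk => ?_
  have hkη : η * k < 1 := (lt_div_iff₀ hk0).1 hηk
  have hlim : Filter.Tendsto (fun X : ℝ => (2 ^ k : ℝ) * X ^ (-(1 - η * k))) Filter.atTop
      (nhds 0) := by
    simpa using (tendsto_rpow_neg_atTop (sub_pos.2 hkη)).const_mul (2 ^ k : ℝ)
  obtain ⟨X₀, hX₀⟩ := Filter.eventually_atTop.1
    ((hlim.eventually_lt_const one_pos).and (Filter.eventually_ge_atTop 1))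
  refine ⟨max X₀ 1, by positivity, fun X hX => ?_⟩
  obtain ⟨hsmall, hX1⟩ := hX₀ X ((le_max_left _ _).trans hX)
  have hX0 : 0 < X := one_pos.trans_le hX1
  have hp1 : 1 ≤ X ^ η := Real.one_le_rpow hX1 hη.le
  have hN : 0 < ⌈X ^ η⌉₊ := Nat.ceil_pos.2 (one_pos.trans_le hp1)
  obtain ⟨v, hv, hv0, hvi⟩ := exists_simultaneous_approx ζ (N := ⌈X ^ η⌉₊) (Q := ⌊X⌋₊) hN (by
    refine Nat.le_floor ?_
    have hc : (⌈X ^ η⌉₊ : ℝ) ≤ 2 * X ^ η := by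
      linarith [Nat.ceil_lt_add_one (zero_le_one.trans hp1)]
    have e : (X ^ η) ^ k = X * X ^ (-(1 - η * k)) := by
      rw [← Real.rpow_natCast, ← Real.rpow_mul hX0.le]
      nth_rewrite 2 [← Real.rpow_one X]
      rw [← Real.rpow_add hX0]
      congr 1
      ring
    push_cast
    calc (⌈X ^ η⌉₊ : ℝ) ^ k ≤ (2 * X ^ η) ^ k := by gcongr
      _ = X * (2 ^ k * X ^ (-(1 - η * k))) := by rw [mul_pow, e]; ring
      _ ≤ X * 1 := by gcongr
      _ = X := mul_one X)
  refine ⟨fun _ => v, linearIndependent_unique_iff.2 hv, fun _ => ⟨?_, fun i => ?_⟩⟩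
  · have : |(v 0 : ℝ)| ≤ (⌊X⌋₊ : ℝ) := by exact_mod_cast hv0
    exact this.trans (Nat.floor_le hX0.le)
  · refine (hvi i).trans ?_
    rw [Real.rpow_neg hX0.le, ← one_div]
    gcongr
    exact Nat.le_ceil _

theorem zero_le_lamHat {k : ℕ} (ζ : Fin k → ℝ) {j : ℕ} (hj : j ≤ k + 1) : 0 ≤ lamHat ζ j := by
  refine le_sSup ⟨0, rfl, 1, one_pos, fun X hX => HasIndepSolutions.of_le hj ?_⟩
  -- For `η = 0` an error of 1 is allowed: this vector and the unit vectors `e_1, …, e_k` suffice.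
  let z : Fin (k + 1) → ℤ := Fin.cons 1 fun i => ⌊ζ i⌋
  refine ⟨Fin.cons z fun i => Pi.single i.succ 1, ?_, fun s => ?_⟩
  · rw [Fintype.linearIndependent_iff]
    intro g hg
    have h := fun t => congrFun hg t
    simp only [Fin.sum_univ_succ, Fin.cons_zero, Fin.cons_succ, Finset.sum_apply,
      Pi.smul_apply, smul_eq_mul, Pi.zero_apply] at h
    have h0 : g 0 = 0 := by simpa [z] using h 0
    intro i
    rcases Fin.eq_zero_or_eq_succ i with hi | ⟨i, hi⟩ <;> rw [hi]
    · exact h0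
    · simpa [h0, Pi.single_apply] using h i.succ
  · rw [neg_zero, Real.rpow_zero]
    rcases Fin.eq_zero_or_eq_succ s with hs | ⟨s, hs⟩ <;> rw [hs]
    · refine ⟨by simpa [z] using hX, fun i => ?_⟩
      simp only [z, Fin.cons_zero, Fin.cons_succ, Int.cast_one, mul_one]
      rw [abs_le]
      constructor <;> linarith [Int.floor_le (ζ i), Int.lt_floor_add_one (ζ i)]
    · refine ⟨by simpa using zero_le_one.trans hX, fun i => ?_⟩
      by_cases h : i = s <;> simp [h]

/-! ### Ordinary lower bounds through the integer map. -/

/-- The integer map `y ↦ (b * y (i + 1) - a * y i)` is surjective for coprime `a` and `b`. -/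
theorem exists_mul_sub_mul_eq {a b : ℤ} (hab : IsCoprime a b) (d : ℕ → ℤ) (k : ℕ) :
    ∃ y : ℕ → ℤ, ∀ i < k, b * y (i + 1) - a * y i = d i := by
  induction k with
  | zero => exact ⟨0, by simp⟩
  | succ k ih =>
    obtain ⟨y, hy⟩ := ih
    obtain ⟨u, w, huw⟩ := (hab.pow_left : IsCoprime (a ^ (k + 1)) b)
    set c := a * y k + d k with hc
    -- Adding a multiple of the kernel vector preserves the earlier equations; Bézout for `a^(k+1)`
    -- and `b` solves the new one.
    refine ⟨fun i => if i ≤ k then y i - c * u * (a ^ i * b ^ (k - i)) else c * w, fun i hi => ?_⟩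
    rcases (Nat.lt_succ_iff.1 hi).lt_or_eq with h | rfl
    · simp only [if_pos h.le, if_pos (Nat.succ_le_of_lt h)]
      obtain ⟨e, rfl⟩ := Nat.exists_eq_add_of_lt h
      rw [show i + e + 1 - (i + 1) = e by omega, show i + e + 1 - i = e + 1 by omega, ← hy i h]
      ring
    · simp only [le_refl, if_true, if_neg (Nat.not_succ_le_self i), Nat.sub_self]
      linear_combination c * huw + hc

/-- The kernel vector starts with `b^k`, so the first coordinate can be reduced modulo `b^k`. -/
theorem exists_mul_sub_mul_eq_of_abs_le {a b : ℤ} (hab : IsCoprime a b) (hb : 0 < b) (d : ℕ → ℤ)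
    (k : ℕ) :
    ∃ y : ℕ → ℤ, |y 0| ≤ b ^ k ∧ ∀ i < k, b * y (i + 1) - a * y i = d i := by
  obtain ⟨y, hy⟩ := exists_mul_sub_mul_eq hab d k
  have hbk : 0 < b ^ k := pow_pos hb k
  refine ⟨fun i => y i - y 0 / b ^ k * (a ^ i * b ^ (k - i)), ?_, fun i hi => ?_⟩
  · have h1 := Int.emod_nonneg (y 0) hbk.ne'
    have h2 := Int.emod_lt_of_pos (y 0) hbk
    have h3 := Int.emod_add_mul_ediv (y 0) (b ^ k)
    simp only [pow_zero, one_mul, Nat.sub_zero]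
    rw [abs_le]
    constructor <;> linarith
  · obtain ⟨e, rfl⟩ := Nat.exists_eq_add_of_lt hi
    simp only
    rw [show i + e + 1 - (i + 1) = e by omega, show i + e + 1 - i = e + 1 by omega, ← hy i hi]
    ring

theorem abs_pow_mul_sub_le {r M b : ℝ} (hb : 0 < b) (hr : |r| ≤ M) (hM : 1 ≤ M) {k : ℕ} {y : ℕ → ℝ}
    (hy : ∀ i < k, |b * y (i + 1) - b * r * y i| ≤ 1) {i : ℕ} (hi : i ≤ k) :
    |r ^ i * y 0 - y i| ≤ i * M ^ i / b := by
  induction i with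
  | zero => simp
  | succ i ih =>
    have h1 := ih (by omega)
    have h2 := hy i hi
    have e : r ^ (i + 1) * y 0 - y (i + 1) =
        r * (r ^ i * y 0 - y i) - (b * y (i + 1) - b * r * y i) / b := by
      field_simp
      ring
    have hM0 : 0 ≤ M := zero_le_one.trans hM
    rw [e]
    calc _ ≤ |r| * |r ^ i * y 0 - y i| + |b * y (i + 1) - b * r * y i| / b := by
          refine (abs_sub _ _).trans ?_
          rw [abs_mul, abs_div, abs_of_pos hb]
      _ ≤ M * (i * M ^ i / b) + M ^ (i + 1) / b := by
          have : 1 ≤ M ^ (i + 1) := one_le_pow₀ hM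
          gcongr
          exact h2.trans this
      _ = _ := by
          push_cast
          ring

/-- Close to a rational number `a / b` the first `k` powers of `ζ` have `k + 1` linearly independent
approximations of quality `1 / b` and first coordinate at most `b ^ k`. -/
theorem one_div_le_lam {ζ : ℝ} (hζ : Liouville ζ) {k : ℕ} (hk : 1 ≤ k) {j : ℕ} (hj : j ≤ k + 1) :
    ((1 / (k : ℝ) : ℝ) : EReal) ≤ lam (powerVec k ζ) j := by
  have hk0 : (0 : ℝ) < k := by exact_mod_cast hk
  refine le_lam (by positivity) fun η hη hηk X₀ => ?_
  have hkη : k * η < 1 := by rw [mul_comm]; exact (lt_div_iff₀ hk0).1 hηk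
  set M : ℝ := |ζ| + 1 with hM
  have hM1 : 1 ≤ M := by simp [hM]
  have hlim : Filter.Tendsto (fun b : ℝ => (2 * k * M ^ k) * b ^ (-(1 - k * η)))
      Filter.atTop (nhds 0) := by
    simpa using (tendsto_rpow_neg_atTop (sub_pos.2 hkη)).const_mul (2 * k * M ^ k)
  obtain ⟨B, hB⟩ := Filter.eventually_atTop.1 (tendsto_natCast_atTop_atTop.eventually
    ((hlim.eventually_lt_const one_pos).and (Filter.eventually_ge_atTop X₀)))
  obtain ⟨r, hrB, hr⟩ := exists_rat_close hζ (k + 1) B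
  obtain ⟨hsmall, hX⟩ := hB r.den hrB
  have hbZ : (0 : ℤ) < r.den := by exact_mod_cast r.den_pos
  have hb1 : (1 : ℝ) ≤ r.den := by exact_mod_cast r.den_pos
  set b : ℝ := (r.den : ℝ) with hb
  have hb0 : 0 < b := one_pos.trans_le hb1
  have hr1 : |ζ - r| ≤ 1 := hr.trans (div_le_one_of_le₀ (one_le_pow₀ hb1) (by positivity))
  have hrM : |(r : ℝ)| ≤ M := abs_cast_le_of_abs_sub_le_one hr1
  refine ⟨b ^ k, hX.trans (le_self_pow₀ hb1 (by omega)), by positivity,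
    HasIndepSolutions.of_le hj ?_⟩
  have hcop : IsCoprime r.num r.den := Int.isCoprime_iff_nat_coprime.2 (by simpa using r.reduced)
  -- `s = 0` gives the kernel vector, the other `s` lifts of the unit vectors. Applying the map to a
  -- linear relation then kills every coefficient but that of the kernel vector.
  have hex : ∀ s : Fin (k + 1), ∃ y : ℕ → ℤ, (s = 0 → y 0 ≠ 0) ∧ |y 0| ≤ (r.den : ℤ) ^ k ∧
      ∀ i < k, (r.den : ℤ) * y (i + 1) - r.num * y i = if (s : ℕ) = i + 1 then 1 else 0 := by
    intro s
    rcases Fin.eq_zero_or_eq_succ s with rfl | ⟨m, rfl⟩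
    · refine ⟨fun i => r.num ^ i * (r.den : ℤ) ^ (k - i), fun _ => by simp, ?_, fun i hi => ?_⟩
      · simp
      · obtain ⟨e, rfl⟩ := Nat.exists_eq_add_of_lt hi
        simp only
        rw [show i + e + 1 - (i + 1) = e by omega, show i + e + 1 - i = e + 1 by omega,
          if_neg (by simp)]
        ring
    · obtain ⟨y, hy0, hy⟩ := exists_mul_sub_mul_eq_of_abs_le hcop hbZ
        (fun i => if (m.succ : ℕ) = i + 1 then 1 else 0) k
      exact ⟨y, fun h => absurd h (Fin.succ_ne_zero m), hy0, hy⟩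
  choose y hy0 hyb hy using hex
  refine ⟨fun s i => y s i, ?_, fun s => ?_⟩
  · rw [Fintype.linearIndependent_iff]
    intro g hg
    have h : ∀ i : Fin (k + 1), ∑ s, g s * y s i = 0 := fun i => by
      simpa using congrFun hg i
    have hsucc : ∀ i : Fin k, g i.succ = 0 := by
      intro i
      have h1 : ∑ s, g s * ((r.den : ℤ) * y s ((i : ℕ) + 1) - r.num * y s i) = 0 := by
        have e1 := h i.succ
        have e2 := h i.castSucc
        rw [Fin.val_succ] at e1
        rw [Fin.val_castSucc] at e2
        calc _ = (r.den : ℤ) * ∑ s, g s * y s ((i : ℕ) + 1) - r.num * ∑ s, g s * y s i := by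
              rw [Finset.mul_sum, Finset.mul_sum, ← Finset.sum_sub_distrib]
              exact Finset.sum_congr rfl fun s _ => by ring
          _ = 0 := by rw [e1, e2]; ring
      rw [Finset.sum_congr rfl fun s _ => by rw [hy s i i.2],
        Finset.sum_eq_single i.succ] at h1
      · simpa using h1
      · intro s _ hs
        rw [if_neg fun h => hs (Fin.ext (by simpa using h)), mul_zero]
      · simp
    have hzero : g 0 = 0 := by
      have h0 := h 0
      rw [Fin.sum_univ_succ] at h0
      simp only [hsucc, zero_mul, Finset.sum_const_zero, add_zero] at h0
      exact (mul_eq_zero.1 h0).resolve_right (hy0 0 rfl)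
    intro i
    rcases Fin.eq_zero_or_eq_succ i with hi | ⟨i, hi⟩ <;> rw [hi]
    · exact hzero
    · exact hsucc i
  · have hx : |(y s 0 : ℝ)| ≤ b ^ k := by
      rw [hb]
      exact_mod_cast hyb s
    refine ⟨by simpa using hx, fun i => ?_⟩
    have hik : (i : ℕ) + 1 ≤ k := i.2
    have h1 := abs_pow_mul_sub_le (y := fun i => (y s i : ℝ)) hb0 hrM hM1 (fun i hi => by
      rw [hb, ← cast_num_eq]
      have : |(r.den : ℤ) * y s (i + 1) - r.num * y s i| ≤ 1 := by
        rw [hy s i hi]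
        split_ifs <;> simp
      exact_mod_cast this) hik
    have h2 := abs_pow_sub_pow_le_of_abs_le (by simp [hM] : |ζ| ≤ M) hrM hM1 hik
    have h3 : (((i : ℕ) + 1 : ℕ) : ℝ) * M ^ ((i : ℕ) + 1) / b ≤ k * M ^ k / b := by
      have : (((i : ℕ) + 1 : ℕ) : ℝ) ≤ k := by exact_mod_cast hik
      gcongr
    have e : powerVec k ζ i * (y s 0 : ℝ) - y s ((i : ℕ) + 1) =
        (ζ ^ ((i : ℕ) + 1) - (r : ℝ) ^ ((i : ℕ) + 1)) * y s 0 +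
          ((r : ℝ) ^ ((i : ℕ) + 1) * y s 0 - y s ((i : ℕ) + 1)) := by
      rw [powerVec]
      ring
    simp only [Fin.val_zero, Fin.val_succ]
    rw [e]
    calc _ ≤ |ζ ^ ((i : ℕ) + 1) - (r : ℝ) ^ ((i : ℕ) + 1)| * |(y s 0 : ℝ)| +
            |(r : ℝ) ^ ((i : ℕ) + 1) * y s 0 - y s ((i : ℕ) + 1)| := by
          rw [← abs_mul]
          exact abs_add_le _ _
      _ ≤ k * M ^ k * (1 / b ^ (k + 1)) * b ^ k + k * M ^ k / b := by
          refine add_le_add (mul_le_mul (h2.trans ?_) hx (abs_nonneg _) (by positivity))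
            (h1.trans h3)
          gcongr
      _ = b ^ (-(k * η)) * (2 * k * M ^ k * b ^ (-(1 - k * η))) := by
          have e1 : b ^ (-(k * η)) * b ^ (-(1 - k * η)) = 1 / b := by
            rw [← Real.rpow_add hb0, one_div, ← Real.rpow_neg_one]
            congr 1
            ring
          rw [mul_left_comm, e1, pow_succ]
          field_simp
          ring
      _ ≤ b ^ (-(k * η)) * 1 := by gcongr
      _ = (b ^ k) ^ (-η) := by
          rw [mul_one, ← Real.rpow_natCast, ← Real.rpow_mul hb0.le, mul_neg]

theorem lam_one_eq_top {ζ : ℝ} (hζ : Liouville ζ) {k : ℕ} (hk : 1 ≤ k) :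
    lam (powerVec k ζ) 1 = ⊤ := by
  rw [EReal.eq_top_iff_forall_lt]
  intro η'
  refine (EReal.coe_lt_coe_iff.2 (lt_add_one η')).trans_le (le_sSup ⟨η' + 1, rfl, fun X₀ => ?_⟩)
  set η := η' + 1
  set M : ℝ := |ζ| + 1 with hM
  have hM1 : 1 ≤ M := by simp [hM]
  -- Once `k M^k ≤ b`, the error is at most `b · b^(-n) · b^k ≤ (b^k)^(-η)`.
  obtain ⟨n, hn⟩ := exists_nat_ge (k + k * η + 1)
  obtain ⟨B, hB⟩ := Filter.eventually_atTop.1 (tendsto_natCast_atTop_atTop.eventually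
    ((Filter.eventually_ge_atTop (k * M ^ k)).and (Filter.eventually_ge_atTop X₀)))
  obtain ⟨r, hrB, hr⟩ := exists_rat_close hζ n B
  obtain ⟨hsmall, hX⟩ := hB r.den hrB
  have hb1 : (1 : ℝ) ≤ r.den := by exact_mod_cast r.den_pos
  have hnum := cast_num_eq r
  set b : ℝ := (r.den : ℝ) with hb
  have hb0 : 0 < b := one_pos.trans_le hb1
  have hr1 : |ζ - r| ≤ 1 := hr.trans (div_le_one_of_le₀ (one_le_pow₀ hb1) (by positivity))
  have hrM : |(r : ℝ)| ≤ M := abs_cast_le_of_abs_sub_le_one hr1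
  refine ⟨b ^ k, hX.trans (le_self_pow₀ hb1 (by omega)), by positivity,
    fun _ i => r.num ^ (i : ℕ) * (r.den : ℤ) ^ (k - (i : ℕ)),
    linearIndependent_unique_iff.2 fun h => ?_, fun _ => ⟨by simp [hb], fun i => ?_⟩⟩
  · simpa using congrFun h 0
  · have hik : (i : ℕ) + 1 ≤ k := i.2
    have h2 := abs_pow_sub_pow_le_of_abs_le (by simp [hM] : |ζ| ≤ M) hrM hM1 hik
    have e : powerVec k ζ i * b ^ k - (b * r) ^ ((i : ℕ) + 1) * b ^ (k - ((i : ℕ) + 1)) =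
        (ζ ^ ((i : ℕ) + 1) - (r : ℝ) ^ ((i : ℕ) + 1)) * b ^ k := by
      rw [powerVec, mul_pow, mul_right_comm, ← pow_add, Nat.add_sub_cancel' hik]
      ring
    simp only [Fin.val_zero, Fin.val_succ, pow_zero, one_mul, Nat.sub_zero]
    push_cast
    rw [hnum, ← hb, e, abs_mul, abs_of_pos (pow_pos hb0 k)]
    calc _ ≤ k * M ^ k * (1 / b ^ n) * b ^ k := by
          gcongr
          exact h2.trans (by gcongr)
      _ ≤ b * (1 / b ^ n) * b ^ k := by gcongr
      _ = b ^ (1 + k - n : ℝ) := by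
          rw [Real.rpow_sub hb0, Real.rpow_add hb0, Real.rpow_one, Real.rpow_natCast,
            Real.rpow_natCast]
          ring
      _ ≤ b ^ (k * -η) := Real.rpow_le_rpow_of_exponent_le hb1 (by linarith)
      _ = (b ^ k) ^ (-η) := by rw [← Real.rpow_natCast, ← Real.rpow_mul hb0.le]

end SimApprox

theorem mainTheorem1 (ζ : ℝ) (hζ : Liouville ζ) (k : ℕ) (hk : 1 ≤ k) :
    SimApprox.lam (SimApprox.powerVec k ζ) 1 = ⊤ ∧
    (∀ j : ℕ, 2 ≤ j → j ≤ k + 1 →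
      (((1 / (k : ℝ)) : ℝ) : EReal) ≤ SimApprox.lam (SimApprox.powerVec k ζ) j ∧
      SimApprox.lam (SimApprox.powerVec k ζ) j ≤ (((1 / ((j : ℝ) - 1)) : ℝ) : EReal)) ∧
    SimApprox.lamHat (SimApprox.powerVec k ζ) 1 = (((1 / (k : ℝ)) : ℝ) : EReal) ∧
    (∀ j : ℕ, 2 ≤ j → j ≤ k + 1 →
      SimApprox.lamHat (SimApprox.powerVec k ζ) j = 0) := by
  refine ⟨SimApprox.lam_one_eq_top hζ hk, fun j hj hjk =>
    ⟨SimApprox.one_div_le_lam hζ hk hjk, SimApprox.lam_le _ hj⟩,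
    le_antisymm (SimApprox.lamHat_one_le hζ hk) (SimApprox.one_div_le_lamHat_one hk _),
    fun j hj hjk => le_antisymm (SimApprox.lamHat_le_zero hζ k hj) (SimApprox.zero_le_lamHat _ hjk)⟩
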